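/- Let $F$ be a cumulative distribution function on $\mathbb{R}$ that is continuous and has full support on a compact interval (the support of $F$ is $[\ell,h]$), let $\tau\in(0,1)$, and let $v_S:\mathbb{R}\to\mathbb{R}$ be upper semicontinuous. Write $F^{-1}(\tau):=\inf\{x: F(x)\ge\tau\}$, \[ F_L^\tau(x):=\min\{F(x)/\tau,\,1\},\qquad F_R^\tau(x):=\max\{(F(x)-\tau)/(1-\tau),\,0\}, \] and let $\mathcal{I}(F_R^\tau,F_L^\tau)$ be the set of nondecreasing right-continuous functions $H:\mathbb{R}\to\mathbb{R}$ with $F_R^\tau\le H\le F_L^\tau$ pointwise. The quantile persuasion problem is \[ \sup_{H\in\mathcal{I}(F_R^\tau,F_L^\tau)}\int_{\mathbb{R}} v_S\,dH, \tag{P} \] where the integral takes values in $[-\infty,\infty)$; $H$ solves (P) if $H\in\mathcal{I}(F_R^\tau,F_L^\tau)$ and it attains this supremum. For $a\in\mathbb{R}$ let $H^L_a(x):=0$ for $x<a$ and $H^L_a(x):=F_L^\tau(x)$ for $x\ge a$; let $H^R_a(x):=F_R^\tau(x)$ for $x<a$ and $H^R_a(x):=1$ for $x\ge a$. For $\underline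 a\le\overline a$ with $F_L^\tau(\underline a)=F_R^\tau(\overline a)=:\eta$ let $H^C_{\underline a,\overline a}(x):=F_L^\tau(x)$ for $x<\underline a$, $:=\eta$ for $x\in[\underline a,\overline a)$, and $:=F_R^\tau(x)$ for $x\ge\overline a$. Then: (i) If $v_S$ is quasi-concave and attains its maximum at $a\le F^{-1}(\tau)$, then $H^L_a$ solves (P). (ii) If $v_S$ is quasi-concave and attains its maximum at $a>F^{-1}(\tau)$, then $H^R_a$ solves (P). (iii) If $v_S$ is strictly quasi-convex, that is, $v_S(sx+(1-s)y)<\max\{v_S(x),v_S(y)\}$ for all $x\ne y$ and $s\in(0,1)$, then $H^C_{\underline a,\overline a}$ solves (P) for some $\underline a\le\overline a$ with $F_L^\tau(\underline a)=F_R^\tau(\overline a)$. (iv) $F$ is never the unique solution of (P). -/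

import Mathlib

open Set Filter Topology MeasureTheory
open scoped ENNReal

noncomputable section

namespace QuantilePersuasion

/-- The set of nondecreasing right-continuous functions lying pointwise between `lower` and
`upper` (a nondecreasing right-continuous function is a `StieltjesFunction`). -/
def monotoneInterval (lower upper : ℝ → ℝ) : Set (StieltjesFunction ℝ) :=
  {H | ∀ x, lower x ≤ H x ∧ H x ≤ upper x}

/-- `G` is a cumulative distribution function. -/
def IsCDF (G : StieltjesFunction ℝ) : Prop :=
  Tendsto G atBot (𝓝 0) ∧ Tendsto G atTop (𝓝 1)

/-- The quantile function `G⁻¹(τ) = inf {x | G x ≥ τ}`. -/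
def quantile (G : ℝ → ℝ) (τ : ℝ) : ℝ := sInf {x | τ ≤ G x}

/-- Left truncation `min {F / τ, 1}` of the prior. -/
def leftTrunc (F : ℝ → ℝ) (τ : ℝ) (x : ℝ) : ℝ := min (1 / τ * F x) 1

/-- Right truncation `max {(F - τ) / (1 - τ), 0}` of the prior. -/
def rightTrunc (F : ℝ → ℝ) (τ : ℝ) (x : ℝ) : ℝ := max ((F x - τ) / (1 - τ)) 0

/-- The Lebesgue–Stieltjes integral `∫ v dH` as an extended real number, i.e. the integral of the
positive part minus the integral of the negative part. An upper semicontinuous `v` is bounded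
above on compact sets but possibly unbounded below, so the value may be `-∞`. -/
def payoff (v : ℝ → ℝ) (H : StieltjesFunction ℝ) : EReal :=
  ((∫⁻ x, ENNReal.ofReal (v x) ∂H.measure : ℝ≥0∞) : EReal) -
    ((∫⁻ x, ENNReal.ofReal (-v x) ∂H.measure : ℝ≥0∞) : EReal)

/-- The function `H` attains the supremum of `∫ v dH` over the monotone function interval between
the right truncation and the left truncation of the prior `F`. -/
def Solves (F : ℝ → ℝ) (τ : ℝ) (v H : ℝ → ℝ) : Prop :=
  ∃ G ∈ monotoneInterval (rightTrunc F τ) (leftTrunc F τ), (∀ x, G x = H x) ∧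
    payoff v G = ⨆ K ∈ monotoneInterval (rightTrunc F τ) (leftTrunc F τ), payoff v K

open Classical in
/-- `H^L_a`: zero below `a`, the left truncation from `a` on. -/
def HL (F : ℝ → ℝ) (τ a x : ℝ) : ℝ := if x < a then 0 else leftTrunc F τ x

open Classical in
/-- `H^R_a`: the right truncation below `a`, one from `a` on. -/
def HR (F : ℝ → ℝ) (τ a x : ℝ) : ℝ := if x < a then rightTrunc F τ x else 1

open Classical in
/-- `H^C_{a,b}`: the left truncation below `a`, the constant `η = F_L(a)` on `[a, b)`, the right
truncation from `b` on. It is used for `a ≤ b` with `F_L(a) = F_R(b)`. -/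
def HC (F : ℝ → ℝ) (τ a b x : ℝ) : ℝ :=
  if x < a then leftTrunc F τ x else if x < b then leftTrunc F τ a else rightTrunc F τ x

/-- Strict quasi-convexity: strictly between two distinct points, `v` is smaller than its larger
endpoint value. -/
def StrictQuasiconvex (v : ℝ → ℝ) : Prop :=
  ∀ x y : ℝ, x ≠ y → ∀ s t : ℝ, 0 < s → 0 < t → s + t = 1 →
    v (s * x + t * y) < max (v x) (v y)

end QuantilePersuasion

end

/-!
A distribution function `H` lies between the truncations of `F` only if, for every `u ∈ (0, 1)`, its
quantile `H⁻¹(u)` lies between `F⁻¹(τ u)` and `F⁻¹(τ + (1 - τ) u)`, the quantiles of the two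
truncations. Since `∫ v dH = ∫₀¹ v (H⁻¹ u) du`, it suffices to maximise `v` over this interval
separately for each `u`. A quasi-concave `v` is maximised at the point of the interval closest to
its peak. A quasi-convex `v` is maximised at an endpoint, and once the right endpoint is strictly
better it stays at least as good when both endpoints move right, so there is a single switch
from the left to the right endpoint as `u` grows.

For non-uniqueness, `F` is the midpoint of the feasible distributions `F ± ε F (1 - F)`, and the
better of these two does at least as well as `F`.
-/

namespace QuantilePersuasion

section Quasiconvexity

variable {𝕜 β : Type*} [Field 𝕜] [LinearOrder 𝕜] [IsStrictOrderedRing 𝕜]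

lemma isMaxOn_Ici_max_of_quasiconcaveOn [Preorder β] {v : 𝕜 → β} (hv : QuasiconcaveOn 𝕜 univ v)
    {a : 𝕜} (ha : ∀ x, v x ≤ v a) (l : 𝕜) : IsMaxOn v (Ici l) (max a l) := by
  intro z hlz
  rcases le_total l a with hla | hal
  · rw [max_eq_left hla]
    exact ha z
  · rw [max_eq_right hal]
    exact ((hv (v z)).ordConnected.out ⟨mem_univ a, ha z⟩ ⟨mem_univ z, le_rfl⟩ ⟨hal, hlz⟩).2

lemma isMaxOn_Iic_min_of_quasiconcaveOn [Preorder β] {v : 𝕜 → β} (hv : QuasiconcaveOn 𝕜 univ v)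
    {a : 𝕜} (ha : ∀ x, v x ≤ v a) (r : 𝕜) : IsMaxOn v (Iic r) (min a r) := by
  intro z hzr
  rcases le_total a r with har | hra
  · rw [min_eq_left har]
    exact ha z
  · rw [min_eq_right hra]
    exact ((hv (v z)).ordConnected.out ⟨mem_univ z, le_rfl⟩ ⟨mem_univ a, ha z⟩ ⟨hzr, hra⟩).2

lemma le_max_of_quasiconvexOn [LinearOrder β] {v : 𝕜 → β} (hv : QuasiconvexOn 𝕜 univ v)
    {x y z : 𝕜} (hz : z ∈ Icc x y) : v z ≤ max (v x) (v y) :=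
  ((hv _).ordConnected.out ⟨mem_univ x, le_max_left _ _⟩ ⟨mem_univ y, le_max_right _ _⟩ hz).2

lemma le_of_quasiconvexOn_of_lt [LinearOrder β] {v : 𝕜 → β} (hv : QuasiconvexOn 𝕜 univ v)
    {l r l' r' : 𝕜} (hlt : v l < v r) (hlr : l ≤ r) (hll : l ≤ l') (hrr : r ≤ r') (hlr' : l' ≤ r') :
    v l' ≤ v r' := by
  have hr : v r ≤ v r' :=
    (le_max_iff.1 (le_max_of_quasiconvexOn hv ⟨hlr, hrr⟩)).resolve_left hlt.not_ge
  exact (le_max_of_quasiconvexOn hv ⟨hll, hlr'⟩).trans (max_le (hlt.le.trans hr) le_rfl)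

lemma exists_switch_of_quasiconvexOn [LinearOrder β] {v : 𝕜 → β} (hv : QuasiconvexOn 𝕜 univ v)
    {p q : ℝ} (hpq : p ≤ q) {l r : ℝ → 𝕜} (hl : MonotoneOn l (Ioo p q))
    (hr : MonotoneOn r (Ioo p q)) (hlr : ∀ u ∈ Ioo p q, l u ≤ r u) :
    ∃ η ∈ Icc p q, ∀ u ∈ Ioo p q, (u < η → IsMaxOn v (Icc (l u) (r u)) (l u)) ∧
      (η < u → IsMaxOn v (Icc (l u) (r u)) (r u)) := by
  let S : Set ℝ := insert q {u ∈ Ioo p q | v (l u) < v (r u)}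
  have hpS : p ∈ lowerBounds S := by
    rintro u (rfl | hu)
    exacts [hpq, hu.1.1.le]
  have hqS : q ∈ S := mem_insert _ _
  refine ⟨sInf S, ⟨le_csInf ⟨q, hqS⟩ hpS, csInf_le ⟨p, hpS⟩ hqS⟩, fun u hu => ⟨fun hlt => ?_,
    fun hgt => ?_⟩⟩
  · have hle : v (r u) ≤ v (l u) := not_lt.1 fun h =>
      notMem_of_lt_csInf hlt ⟨p, hpS⟩ (mem_insert_of_mem _ ⟨hu, h⟩)
    exact fun z hz => (le_max_of_quasiconvexOn hv hz).trans (max_le le_rfl hle)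
  · obtain ⟨w, rfl | ⟨hw, hvw⟩, hwu⟩ := (csInf_lt_iff ⟨p, hpS⟩ ⟨q, hqS⟩).1 hgt
    · exact absurd hu.2 hwu.not_gt
    have hle : v (l u) ≤ v (r u) := le_of_quasiconvexOn_of_lt hv hvw (hlr w hw)
      (hl hw hu hwu.le) (hr hw hu hwu.le) (hlr u hu)
    exact fun z hz => (le_max_of_quasiconvexOn hv hz).trans (max_le hle le_rfl)

variable {v : ℝ → ℝ}

lemma measurable_of_quasiconvexOn (hv : QuasiconvexOn ℝ univ v) : Measurable v :=
  measurable_of_Iic fun c => by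
    simpa only [mem_univ, true_and, preimage, mem_Iic] using (hv c).ordConnected.measurableSet

lemma measurable_of_quasiconcaveOn (hv : QuasiconcaveOn ℝ univ v) : Measurable v :=
  measurable_of_Ici fun c => by
    simpa only [mem_univ, true_and, preimage, mem_Ici] using (hv c).ordConnected.measurableSet

lemma StrictQuasiconvex.quasiconvexOn (hv : StrictQuasiconvex v) : QuasiconvexOn ℝ univ v := by
  refine quasiconvexOn_iff_le_max.2 ⟨convex_univ, fun x _ y _ s t hs ht hst => ?_⟩
  rcases eq_or_ne x y with rfl | hxy
  · rw [Convex.combo_self hst, max_self]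
  rcases hs.eq_or_lt with rfl | hs
  · simp [(zero_add t).symm.trans hst]
  rcases ht.eq_or_lt with rfl | ht
  · simp [(add_zero s).symm.trans hst]
  exact (hv x y hxy s t hs ht hst).le

end Quasiconvexity

section CDF

variable {H : StieltjesFunction ℝ}

lemma IsCDF.nonneg (hH : IsCDF H) (x : ℝ) : 0 ≤ H x :=
  H.mono.le_of_tendsto hH.1 x

lemma IsCDF.le_one (hH : IsCDF H) (x : ℝ) : H x ≤ 1 :=
  H.mono.ge_of_tendsto hH.2 x

lemma IsCDF.apply_eq_zero_of_support_subset_Ici (hH : IsCDF H) {lo x : ℝ}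
    (hs : H.measure.support ⊆ Ici lo) (hx : x < lo) : H x = 0 := by
  have hsub : Iic x ⊆ H.measure.supportᶜ := fun y hy h => (hs h).not_gt (hy.trans_lt hx)
  have hnull := measure_mono_null hsub Measure.measure_compl_support
  rw [H.measure_Iic hH.1, sub_zero, ENNReal.ofReal_eq_zero] at hnull
  exact le_antisymm hnull (hH.nonneg x)

lemma IsCDF.apply_eq_one_of_support_subset_Iic (hH : IsCDF H) {hi x : ℝ}
    (hs : H.measure.support ⊆ Iic hi) (hx : hi < x) : H x = 1 := by
  have hsub : Ioi x ⊆ H.measure.supportᶜ := fun y hy h => (hs h).not_gt (hx.trans hy)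
  have hnull := measure_mono_null hsub Measure.measure_compl_support
  rw [H.measure_Ioi hH.2, ENNReal.ofReal_eq_zero] at hnull
  exact le_antisymm (hH.le_one x) (sub_nonpos.1 hnull)

lemma IsCDF.Icc_zero_one_subset_range (hH : IsCDF H) (hc : Continuous H) {lo hi : ℝ}
    (hs : H.measure.support ⊆ Icc lo hi) : Icc 0 1 ⊆ range H := fun _ hy =>
  mem_range_of_exists_le_of_exists_ge hc
    ⟨lo - 1, (hH.apply_eq_zero_of_support_subset_Ici (hs.trans Icc_subset_Ici_self)
      (sub_one_lt lo)).trans_le hy.1⟩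
    ⟨hi + 1, hy.2.trans_eq (hH.apply_eq_one_of_support_subset_Iic (hs.trans Icc_subset_Iic_self)
      (lt_add_one hi)).symm⟩

end CDF

section Quantile

variable {H : StieltjesFunction ℝ} {u : ℝ}

lemma quantile_eq_of_forall_le_iff {G : ℝ → ℝ} {q : ℝ} (h : ∀ x, q ≤ x ↔ u ≤ G x) :
    quantile G u = q := by
  have hset : {x | u ≤ G x} = Ici q := ext fun x => (h x).symm
  rw [quantile, hset, csInf_Ici]

lemma quantile_le_iff (hH : IsCDF H) (hu : u ∈ Ioo (0 : ℝ) 1) {x : ℝ} :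
    quantile H u ≤ x ↔ u ≤ H x := by
  obtain ⟨y, hy⟩ := (hH.1.eventually_lt_const hu.1).exists
  obtain ⟨z, hz⟩ := (hH.2.eventually_const_lt hu.2).exists
  have hne : {x | u ≤ H x}.Nonempty := ⟨z, hz.le⟩
  have hbdd : BddBelow {x | u ≤ H x} := ⟨y, fun _ ht => (H.mono.reflect_lt (hy.trans_le ht)).le⟩
  refine ⟨fun h => ?_, fun h => csInf_le hbdd h⟩
  have hq : u ≤ H (quantile H u) := by
    refine ge_of_tendsto ((H.right_continuous _).mono_left
      (nhdsWithin_mono _ Ioi_subset_Ici_self)) (eventually_nhdsWithin_of_forall fun t ht => ?_)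
    obtain ⟨s, hs, hst⟩ := (csInf_lt_iff hbdd hne).1 ht
    exact le_trans hs (H.mono hst.le)
  exact hq.trans (H.mono h)

lemma le_apply_quantile (hH : IsCDF H) (hu : u ∈ Ioo (0 : ℝ) 1) : u ≤ H (quantile H u) :=
  (quantile_le_iff hH hu).1 le_rfl

lemma monotoneOn_quantile (hH : IsCDF H) : MonotoneOn (quantile H) (Ioo 0 1) :=
  fun _ hu _ hw huw => (quantile_le_iff hH hu).2 (huw.trans (le_apply_quantile hH hw))

lemma aemeasurable_quantile (hH : IsCDF H) :
    AEMeasurable (quantile H) (volume.restrict (Ioo 0 1)) :=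
  aemeasurable_restrict_of_monotoneOn measurableSet_Ioo (monotoneOn_quantile hH)

lemma map_quantile (hH : IsCDF H) :
    (volume.restrict (Ioo (0 : ℝ) 1)).map (quantile H) = H.measure := by
  have : IsFiniteMeasure H.measure := H.isFiniteMeasure hH.1 hH.2
  refine (Measure.ext_of_Iic _ _ fun x => ?_).symm
  rw [H.measure_Iic hH.1, Measure.map_apply_of_aemeasurable (aemeasurable_quantile hH)
    measurableSet_Iic, Measure.restrict_apply' measurableSet_Ioo, sub_zero]
  apply le_antisymm
  · have hsub : Ioo 0 (H x) ⊆ quantile H ⁻¹' Iic x ∩ Ioo 0 1 := fun u hu => by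
      have hu' : u ∈ Ioo (0 : ℝ) 1 := ⟨hu.1, hu.2.trans_le (hH.le_one x)⟩
      exact ⟨(quantile_le_iff hH hu').2 hu.2.le, hu'⟩
    simpa using measure_mono (μ := volume) hsub
  · have hsub : quantile H ⁻¹' Iic x ∩ Ioo 0 1 ⊆ Ioc 0 (H x) := fun u hu =>
      ⟨hu.2.1, (quantile_le_iff hH hu.2).1 hu.1⟩
    simpa using measure_mono (μ := volume) hsub

end Quantile

section Payoff

variable {H K : StieltjesFunction ℝ} {v : ℝ → ℝ}

lemma lintegral_measure_eq_lintegral_quantile (hH : IsCDF H) {f : ℝ → ℝ≥0∞} (hf : Measurable f) :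
    ∫⁻ x, f x ∂H.measure = ∫⁻ u in Ioo 0 1, f (quantile H u) := by
  rw [← map_quantile hH, lintegral_map' hf.aemeasurable (aemeasurable_quantile hH)]

lemma payoff_le_payoff_of_ae_quantile (hH : IsCDF H) (hK : IsCDF K) (hv : Measurable v)
    (h : ∀ᵐ u ∂volume.restrict (Ioo (0 : ℝ) 1), v (quantile H u) ≤ v (quantile K u)) :
    payoff v H ≤ payoff v K := by
  have hv_pos : Measurable fun x => ENNReal.ofReal (v x) := hv.ennreal_ofReal
  have hv_neg : Measurable fun x => ENNReal.ofReal (-v x) := hv.neg.ennreal_ofReal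
  simp only [payoff, lintegral_measure_eq_lintegral_quantile hH hv_pos,
    lintegral_measure_eq_lintegral_quantile hH hv_neg,
    lintegral_measure_eq_lintegral_quantile hK hv_pos,
    lintegral_measure_eq_lintegral_quantile hK hv_neg]
  refine EReal.sub_le_sub ?_ ?_ <;> rw [EReal.coe_ennreal_le_coe_ennreal_iff]
  · exact lintegral_mono_ae (h.mono fun u hu => ENNReal.ofReal_le_ofReal hu)
  · exact lintegral_mono_ae (h.mono fun u hu => ENNReal.ofReal_le_ofReal (neg_le_neg hu))

lemma coe_ennreal_sub_le_sub_of_add_le_add {p n p' n' : ℝ≥0∞} (hn' : n' ≠ ∞)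
    (h : p + n' ≤ p' + n) : (p : EReal) - n ≤ p' - n' := by
  rw [EReal.le_sub_iff_add_le (.inl (EReal.coe_ennreal_ne_bot n')) (.inl (by simpa using hn')),
    sub_eq_add_neg, add_right_comm, ← sub_eq_add_neg]
  exact EReal.sub_le_of_le_add (mod_cast h)

lemma payoff_le_max_of_add_eq_add_self {K₁ K₂ : StieltjesFunction ℝ} (h : K₁ + K₂ = H + H) :
    payoff v H ≤ max (payoff v K₁) (payoff v K₂) := by
  have hsum (f : ℝ → ℝ≥0∞) :
      ∫⁻ x, f x ∂K₁.measure + ∫⁻ x, f x ∂K₂.measure =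
        ∫⁻ x, f x ∂H.measure + ∫⁻ x, f x ∂H.measure := by
    rw [← lintegral_add_measure, ← lintegral_add_measure, ← StieltjesFunction.measure_add, h,
      StieltjesFunction.measure_add]
  have hpos := hsum fun x => ENNReal.ofReal (v x)
  have hneg := hsum fun x => ENNReal.ofReal (-v x)
  unfold payoff
  set p := ∫⁻ x, ENNReal.ofReal (v x) ∂H.measure
  set n := ∫⁻ x, ENNReal.ofReal (-v x) ∂H.measure
  set p₁ := ∫⁻ x, ENNReal.ofReal (v x) ∂K₁.measure
  set n₁ := ∫⁻ x, ENNReal.ofReal (-v x) ∂K₁.measure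
  set p₂ := ∫⁻ x, ENNReal.ofReal (v x) ∂K₂.measure
  set n₂ := ∫⁻ x, ENNReal.ofReal (-v x) ∂K₂.measure
  rcases eq_or_ne n ∞ with hn | hn
  · simp [hn]
  obtain ⟨hn₁, hn₂⟩ : n₁ ≠ ∞ ∧ n₂ ≠ ∞ := by
    rw [← ENNReal.add_ne_top, hneg]
    exact ENNReal.add_ne_top.2 ⟨hn, hn⟩
  have htotal : p + n₁ ≤ p₁ + n ∨ p + n₂ ≤ p₂ + n := by
    by_contra! hlt
    refine (ENNReal.add_lt_add hlt.1 hlt.2).ne ?_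
    calc p₁ + n + (p₂ + n) = p₁ + p₂ + (n + n) := add_add_add_comm _ _ _ _
      _ = p + p + (n₁ + n₂) := by rw [hpos, hneg]
      _ = p + n₁ + (p + n₂) := add_add_add_comm _ _ _ _
  rcases htotal with hle | hle
  · exact (coe_ennreal_sub_le_sub_of_add_le_add hn₁ hle).trans (le_max_left _ _)
  · exact (coe_ennreal_sub_le_sub_of_add_le_add hn₂ hle).trans (le_max_right _ _)

end Payoff

section Truncation

lemma rightTrunc_nonneg (G : ℝ → ℝ) (τ x : ℝ) : 0 ≤ rightTrunc G τ x := le_max_right _ _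

lemma leftTrunc_le_one (G : ℝ → ℝ) (τ x : ℝ) : leftTrunc G τ x ≤ 1 := min_le_right _ _

section Bounds

variable {G : ℝ → ℝ} {τ x y : ℝ}

lemma le_leftTrunc_iff (hτ : 0 < τ) (hy : y ≤ 1) : y ≤ leftTrunc G τ x ↔ τ * y ≤ G x := by
  rw [leftTrunc, le_min_iff, and_iff_left hy, one_div_mul_eq_div, le_div_iff₀' hτ]

lemma rightTrunc_le_iff (hτ : τ < 1) (hy : 0 ≤ y) :
    rightTrunc G τ x ≤ y ↔ G x ≤ τ + (1 - τ) * y := by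
  rw [rightTrunc, max_le_iff, and_iff_left hy, div_le_iff₀' (sub_pos.2 hτ), sub_le_iff_le_add']

lemma le_rightTrunc_iff (hτ : τ < 1) (hy : 0 < y) :
    y ≤ rightTrunc G τ x ↔ τ + (1 - τ) * y ≤ G x := by
  rw [rightTrunc, le_max_iff, or_iff_left hy.not_ge, le_div_iff₀' (sub_pos.2 hτ),
    le_sub_iff_add_le']

lemma leftTrunc_eq_of_apply_eq (hτ : 0 < τ) (hy : y ≤ 1) (h : G x = τ * y) :
    leftTrunc G τ x = y := by
  rw [leftTrunc, h, one_div, inv_mul_cancel_left₀ hτ.ne', min_eq_left hy]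

lemma rightTrunc_eq_of_apply_eq (hτ : τ < 1) (hy : 0 ≤ y) (h : G x = τ + (1 - τ) * y) :
    rightTrunc G τ x = y := by
  rw [rightTrunc, h, add_sub_cancel_left, mul_div_cancel_left₀ _ (sub_pos.2 hτ).ne',
    max_eq_left hy]

lemma rightTrunc_eq_zero (hτ : τ < 1) (h : G x ≤ τ) : rightTrunc G τ x = 0 :=
  le_antisymm ((rightTrunc_le_iff hτ le_rfl).2 (by rwa [mul_zero, add_zero]))
    (rightTrunc_nonneg G τ x)

lemma leftTrunc_eq_one (hτ : 0 < τ) (h : τ ≤ G x) : leftTrunc G τ x = 1 :=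
  le_antisymm (leftTrunc_le_one G τ x) ((le_leftTrunc_iff hτ le_rfl).2 (by rwa [mul_one]))

end Bounds

variable {F H : StieltjesFunction ℝ} {τ u : ℝ}

/-- The left truncation `F_L`, bundled as a nondecreasing right-continuous function. -/
noncomputable def leftStieltjes (F : StieltjesFunction ℝ) (hτ : 0 ≤ τ) :
    StieltjesFunction ℝ where
  toFun := leftTrunc F τ
  mono' _ _ h := min_le_min_right _ (mul_le_mul_of_nonneg_left (F.mono h) (one_div_nonneg.2 hτ))
  right_continuous' x :=
    ((F.right_continuous x).const_mul (1 / τ)).min continuousWithinAt_const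

/-- The right truncation `F_R`, bundled as a nondecreasing right-continuous function. -/
noncomputable def rightStieltjes (F : StieltjesFunction ℝ) (hτ : τ ≤ 1) :
    StieltjesFunction ℝ where
  toFun := rightTrunc F τ
  mono' _ _ h := max_le_max_right _ (div_le_div_of_nonneg_right (sub_le_sub_right (F.mono h) _)
    (sub_nonneg.2 hτ))
  right_continuous' x :=
    (((F.right_continuous x).sub continuousWithinAt_const).div_const (1 - τ)).max
      continuousWithinAt_const

lemma monotone_leftTrunc (hτ : 0 ≤ τ) : Monotone (leftTrunc F τ) := (leftStieltjes F hτ).mono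

lemma monotone_rightTrunc (hτ : τ ≤ 1) : Monotone (rightTrunc F τ) := (rightStieltjes F hτ).mono

lemma leftTrunc_nonneg (hF : IsCDF F) (hτ : 0 < τ) (x : ℝ) : 0 ≤ leftTrunc F τ x :=
  (le_leftTrunc_iff hτ zero_le_one).2 (by simpa using hF.nonneg x)

lemma rightTrunc_le_one (hF : IsCDF F) (hτ : τ < 1) (x : ℝ) : rightTrunc F τ x ≤ 1 :=
  (rightTrunc_le_iff hτ zero_le_one).2 (by simpa using hF.le_one x)

lemma rightTrunc_le_leftTrunc (hF : IsCDF F) (hτ : τ ∈ Ioo (0 : ℝ) 1) (x : ℝ) :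
    rightTrunc F τ x ≤ leftTrunc F τ x := by
  trans F x
  · refine (rightTrunc_le_iff hτ.2 (hF.nonneg x)).2 ?_
    nlinarith [hF.le_one x, hτ.1]
  · exact (le_leftTrunc_iff hτ.1 (hF.le_one x)).2 (mul_le_of_le_one_left (hF.nonneg x) hτ.2.le)

lemma isCDF_of_mem_monotoneInterval (hF : IsCDF F) (hτ : τ < 1)
    (hH : H ∈ monotoneInterval (rightTrunc F τ) (leftTrunc F τ)) : IsCDF H := by
  have hbot : Tendsto (leftTrunc F τ) atBot (𝓝 0) := by
    have hmin := (hF.1.const_mul (1 / τ)).min (tendsto_const_nhds (x := (1 : ℝ)))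
    rwa [mul_zero, min_eq_left zero_le_one] at hmin
  have htop : Tendsto (rightTrunc F τ) atTop (𝓝 1) := by
    have hmax := ((hF.2.sub_const τ).div_const (1 - τ)).max (tendsto_const_nhds (x := (0 : ℝ)))
    rwa [div_self (sub_pos.2 hτ).ne', max_eq_left zero_le_one] at hmax
  exact ⟨tendsto_of_tendsto_of_tendsto_of_le_of_le tendsto_const_nhds hbot
      (fun x => (rightTrunc_nonneg F τ x).trans (hH x).1) fun x => (hH x).2,
    tendsto_of_tendsto_of_tendsto_of_le_of_le htop tendsto_const_nhds
      (fun x => (hH x).1) fun x => (hH x).2.trans (leftTrunc_le_one F τ x)⟩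

lemma mul_mem_Ioo_zero_one (hτ : τ ∈ Ioo (0 : ℝ) 1) (hu : u ∈ Ioo (0 : ℝ) 1) :
    τ * u ∈ Ioo (0 : ℝ) 1 :=
  ⟨mul_pos hτ.1 hu.1, mul_lt_one_of_nonneg_of_lt_one_left hτ.1.le hτ.2 hu.2.le⟩

lemma add_one_sub_mul_mem_Ioo_zero_one (hτ : τ ∈ Ioo (0 : ℝ) 1) (hu : u ∈ Ioo (0 : ℝ) 1) :
    τ + (1 - τ) * u ∈ Ioo (0 : ℝ) 1 :=
  ⟨add_pos hτ.1 (mul_pos (sub_pos.2 hτ.2) hu.1), by nlinarith [hτ.2, hu.2]⟩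

lemma quantile_mul_le_iff (hF : IsCDF F) (hτ : τ ∈ Ioo (0 : ℝ) 1) (hu : u ∈ Ioo (0 : ℝ) 1) {x : ℝ} :
    quantile F (τ * u) ≤ x ↔ u ≤ leftTrunc F τ x := by
  rw [quantile_le_iff hF (mul_mem_Ioo_zero_one hτ hu), le_leftTrunc_iff hτ.1 hu.2.le]

lemma quantile_add_mul_le_iff (hF : IsCDF F) (hτ : τ ∈ Ioo (0 : ℝ) 1) (hu : u ∈ Ioo (0 : ℝ) 1)
    {x : ℝ} : quantile F (τ + (1 - τ) * u) ≤ x ↔ u ≤ rightTrunc F τ x := by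
  rw [quantile_le_iff hF (add_one_sub_mul_mem_Ioo_zero_one hτ hu), le_rightTrunc_iff hτ.2 hu.1]

lemma quantile_mem_Icc_of_mem_monotoneInterval (hF : IsCDF F) (hτ : τ ∈ Ioo (0 : ℝ) 1)
    (hH : H ∈ monotoneInterval (rightTrunc F τ) (leftTrunc F τ)) (hu : u ∈ Ioo (0 : ℝ) 1) :
    quantile H u ∈ Icc (quantile F (τ * u)) (quantile F (τ + (1 - τ) * u)) := by
  have hHc := isCDF_of_mem_monotoneInterval hF hτ.2 hH
  exact ⟨(quantile_mul_le_iff hF hτ hu).2 ((le_apply_quantile hHc hu).trans (hH _).2),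
    (quantile_le_iff hHc hu).2 (((quantile_add_mul_le_iff hF hτ hu).1 le_rfl).trans (hH _).1)⟩

end Truncation

section Glue

variable {R : Type*} [LinearOrder R] [TopologicalSpace R] [OrderTopology R]

open Classical in
/-- The function following `f` to the left of `a` and `g` from `a` on. The candidate solutions are
put together from the truncations and constants in this way. -/
def glue (f g : StieltjesFunction R) (a : R) (h : ∀ x < a, f x ≤ g a) : StieltjesFunction R where
  toFun x := if x < a then f x else g x
  mono' x y hxy := by
    dsimp only
    split_ifs with hx hy hy
    · exact f.mono hxy
    · exact (h x hx).trans (g.mono (not_lt.1 hy))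
    · exact absurd (hxy.trans_lt hy) hx
    · exact g.mono hxy
  right_continuous' x := by
    by_cases hx : x < a
    · refine (f.right_continuous x).congr_of_eventuallyEq ?_ (if_pos hx)
      filter_upwards [mem_nhdsWithin_of_mem_nhds (Iio_mem_nhds hx)] with y hy using if_pos hy
    · exact (g.right_continuous x).congr
        (fun y hy => if_neg ((not_lt.1 hx).trans hy).not_gt) (if_neg hx)

end Glue

section Solutions

variable {F : StieltjesFunction ℝ} {τ : ℝ} {v : ℝ → ℝ}

lemma solves_iff_isMaxOn_payoff {G : ℝ → ℝ} {H : StieltjesFunction ℝ} :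
    Solves G τ v H ↔ H ∈ monotoneInterval (rightTrunc G τ) (leftTrunc G τ) ∧
      IsMaxOn (payoff v) (monotoneInterval (rightTrunc G τ) (leftTrunc G τ)) H := by
  constructor
  · rintro ⟨K, hK, hKH, hmax⟩
    obtain rfl : K = H := StieltjesFunction.ext hKH
    exact ⟨hK, fun J hJ => (le_iSup₂_of_le J hJ le_rfl).trans_eq hmax.symm⟩
  · rintro ⟨hH, hmax⟩
    exact ⟨H, hH, fun _ => rfl, le_antisymm (le_iSup₂_of_le H hH le_rfl) (iSup₂_le hmax)⟩

lemma solves_of_ae_isMaxOn_quantile (hF : IsCDF F) (hτ : τ ∈ Ioo (0 : ℝ) 1) (hv : Measurable v)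
    {H : StieltjesFunction ℝ} (hH : H ∈ monotoneInterval (rightTrunc F τ) (leftTrunc F τ))
    (hmax : ∀ᵐ u, u ∈ Ioo (0 : ℝ) 1 →
      IsMaxOn v (Icc (quantile F (τ * u)) (quantile F (τ + (1 - τ) * u))) (quantile H u)) :
    Solves F τ v H := by
  refine solves_iff_isMaxOn_payoff.2 ⟨hH, fun K hK => payoff_le_payoff_of_ae_quantile
    (isCDF_of_mem_monotoneInterval hF hτ.2 hK) (isCDF_of_mem_monotoneInterval hF hτ.2 hH) hv ?_⟩
  rw [ae_restrict_iff' measurableSet_Ioo]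
  filter_upwards [hmax] with u hu hu01
  exact hu hu01 (quantile_mem_Icc_of_mem_monotoneInterval hF hτ hK hu01)

lemma quantile_HL (hF : IsCDF F) (hτ : τ ∈ Ioo (0 : ℝ) 1) (a : ℝ) {u : ℝ}
    (hu : u ∈ Ioo (0 : ℝ) 1) : quantile (HL F τ a) u = max a (quantile F (τ * u)) := by
  refine quantile_eq_of_forall_le_iff fun x => ?_
  rw [max_le_iff, quantile_mul_le_iff hF hτ hu, HL]
  split_ifs with hx
  · simp [hx.not_ge, hu.1]
  · simp [not_lt.1 hx]

lemma quantile_HR (hF : IsCDF F) (hτ : τ ∈ Ioo (0 : ℝ) 1) (a : ℝ) {u : ℝ}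
    (hu : u ∈ Ioo (0 : ℝ) 1) : quantile (HR F τ a) u = min a (quantile F (τ + (1 - τ) * u)) := by
  refine quantile_eq_of_forall_le_iff fun x => ?_
  rw [min_le_iff, quantile_add_mul_le_iff hF hτ hu, HR]
  split_ifs with hx
  · simp [hx.not_ge]
  · simp [not_lt.1 hx, hu.2.le]

theorem solves_HL (hF : IsCDF F) (hτ : τ ∈ Ioo (0 : ℝ) 1) (hv : QuasiconcaveOn ℝ univ v) {a : ℝ}
    (hmax : ∀ x, v x ≤ v a) (ha : a ≤ quantile F τ) : Solves F τ v (HL F τ a) := by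
  let H := glue (StieltjesFunction.const ℝ 0) (leftStieltjes F hτ.1.le) a
    fun _ _ => leftTrunc_nonneg hF hτ.1 a
  have hH : H ∈ monotoneInterval (rightTrunc F τ) (leftTrunc F τ) := fun x => by
    change rightTrunc F τ x ≤ HL F τ a x ∧ HL F τ a x ≤ leftTrunc F τ x
    rw [HL]
    split_ifs with hx
    · have hFx : F x ≤ τ := (not_le.1 ((quantile_le_iff hF hτ).not.1 (hx.trans_le ha).not_ge)).le
      exact ⟨(rightTrunc_eq_zero hτ.2 hFx).le, leftTrunc_nonneg hF hτ.1 x⟩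
    · exact ⟨rightTrunc_le_leftTrunc hF hτ x, le_rfl⟩
  refine solves_of_ae_isMaxOn_quantile hF hτ (measurable_of_quasiconcaveOn hv) hH
    (.of_forall fun u hu => ?_)
  change IsMaxOn v _ (quantile (HL F τ a) u)
  rw [quantile_HL hF hτ a hu]
  exact (isMaxOn_Ici_max_of_quasiconcaveOn hv hmax _).on_subset Icc_subset_Ici_self

theorem solves_HR (hF : IsCDF F) (hτ : τ ∈ Ioo (0 : ℝ) 1) (hv : QuasiconcaveOn ℝ univ v) {a : ℝ}
    (hmax : ∀ x, v x ≤ v a) (ha : quantile F τ ≤ a) : Solves F τ v (HR F τ a) := by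
  let H := glue (rightStieltjes F hτ.2.le) (StieltjesFunction.const ℝ 1) a
    fun x _ => rightTrunc_le_one hF hτ.2 x
  have hH : H ∈ monotoneInterval (rightTrunc F τ) (leftTrunc F τ) := fun x => by
    change rightTrunc F τ x ≤ HR F τ a x ∧ HR F τ a x ≤ leftTrunc F τ x
    rw [HR]
    split_ifs with hx
    · exact ⟨le_rfl, rightTrunc_le_leftTrunc hF hτ x⟩
    · have hFx : τ ≤ F x := (quantile_le_iff hF hτ).1 (ha.trans (not_lt.1 hx))
      exact ⟨rightTrunc_le_one hF hτ.2 x, (leftTrunc_eq_one hτ.1 hFx).ge⟩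
  refine solves_of_ae_isMaxOn_quantile hF hτ (measurable_of_quasiconcaveOn hv) hH
    (.of_forall fun u hu => ?_)
  change IsMaxOn v _ (quantile (HR F τ a) u)
  rw [quantile_HR hF hτ a hu]
  exact (isMaxOn_Iic_min_of_quasiconcaveOn hv hmax _).on_subset Icc_subset_Iic_self

lemma exists_lt_leftTrunc_eq_rightTrunc_eq (hτ : τ ∈ Ioo (0 : ℝ) 1) (hrange : Icc 0 1 ⊆ range F)
    {η : ℝ} (hη : η ∈ Icc (0 : ℝ) 1) :
    ∃ a b, a < b ∧ leftTrunc F τ a = η ∧ rightTrunc F τ b = η := by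
  obtain ⟨a, ha⟩ := hrange (show τ * η ∈ Icc 0 1 from
    ⟨mul_nonneg hτ.1.le hη.1, mul_le_one₀ hτ.2.le hη.1 hη.2⟩)
  obtain ⟨b, hb⟩ := hrange (show τ + (1 - τ) * η ∈ Icc 0 1 from
    ⟨add_nonneg hτ.1.le (mul_nonneg (sub_nonneg.2 hτ.2.le) hη.1), by nlinarith [hτ.2, hη.2]⟩)
  have hlt : F a < F b := by
    rw [ha, hb]
    rcases hη.2.lt_or_eq with hη1 | rfl
    · linarith [mul_pos hτ.1 (sub_pos.2 hη1), mul_nonneg (sub_nonneg.2 hτ.2.le) hη.1]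
    · linarith [hτ.2]
  exact ⟨a, b, F.mono.reflect_lt hlt, leftTrunc_eq_of_apply_eq hτ.1 hη.2 ha,
    rightTrunc_eq_of_apply_eq hτ.2 hη.1 hb⟩

section Censoring

variable {a b u : ℝ}

lemma quantile_HC_of_lt (hF : IsCDF F) (hτ : τ ∈ Ioo (0 : ℝ) 1)
    (hη : leftTrunc F τ a = rightTrunc F τ b) (hu : u ∈ Ioo (0 : ℝ) 1) (hlt : u < leftTrunc F τ a) :
    quantile (HC F τ a b) u = quantile F (τ * u) := by
  refine quantile_eq_of_forall_le_iff fun x => ?_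
  rw [quantile_mul_le_iff hF hτ hu, HC]
  split_ifs with hxa hxb
  · rfl
  · exact iff_of_true (hlt.le.trans (monotone_leftTrunc hτ.1.le (not_lt.1 hxa))) hlt.le
  · exact iff_of_true (hlt.le.trans (monotone_leftTrunc hτ.1.le (not_lt.1 hxa)))
      (hlt.le.trans (hη.le.trans (monotone_rightTrunc hτ.2.le (not_lt.1 hxb))))

lemma quantile_HC_of_gt (hF : IsCDF F) (hτ : τ ∈ Ioo (0 : ℝ) 1) (hab : a ≤ b)
    (hη : leftTrunc F τ a = rightTrunc F τ b) (hu : u ∈ Ioo (0 : ℝ) 1) (hgt : leftTrunc F τ a < u) :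
    quantile (HC F τ a b) u = quantile F (τ + (1 - τ) * u) := by
  have hR {x : ℝ} (hx : x ≤ b) : rightTrunc F τ x < u :=
    ((monotone_rightTrunc hτ.2.le hx).trans hη.ge).trans_lt hgt
  refine quantile_eq_of_forall_le_iff fun x => ?_
  rw [quantile_add_mul_le_iff hF hτ hu, HC]
  split_ifs with hxa hxb
  · exact iff_of_false (hR (hxa.le.trans hab)).not_ge
      ((monotone_leftTrunc hτ.1.le hxa.le).trans_lt hgt).not_ge
  · exact iff_of_false (hR hxb.le).not_ge hgt.not_ge
  · rfl

lemma exists_mem_monotoneInterval_eq_HC (hF : IsCDF F) (hτ : τ ∈ Ioo (0 : ℝ) 1)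
    (hη : leftTrunc F τ a = rightTrunc F τ b) :
    ∃ H ∈ monotoneInterval (rightTrunc F τ) (leftTrunc F τ), H = HC F τ a b := by
  let M := glue (StieltjesFunction.const ℝ (leftTrunc F τ a)) (rightStieltjes F hτ.2.le) b
    fun _ _ => hη.le
  have hM : leftTrunc F τ a ≤ M a := by
    change _ ≤ if a < b then leftTrunc F τ a else rightTrunc F τ a
    split_ifs with h
    · exact le_rfl
    · exact hη.le.trans (monotone_rightTrunc hτ.2.le (not_lt.1 h))
  let H := glue (leftStieltjes F hτ.1.le) M a
    fun x hx => (monotone_leftTrunc hτ.1.le hx.le).trans hM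
  refine ⟨H, fun x => ?_, rfl⟩
  change rightTrunc F τ x ≤ HC F τ a b x ∧ HC F τ a b x ≤ leftTrunc F τ x
  rw [HC]
  split_ifs with hxa hxb
  · exact ⟨rightTrunc_le_leftTrunc hF hτ x, le_rfl⟩
  · exact ⟨(monotone_rightTrunc hτ.2.le hxb.le).trans hη.ge,
      monotone_leftTrunc hτ.1.le (not_lt.1 hxa)⟩
  · exact ⟨le_rfl, rightTrunc_le_leftTrunc hF hτ x⟩

theorem exists_solves_HC (hF : IsCDF F) (hτ : τ ∈ Ioo (0 : ℝ) 1) (hrange : Icc 0 1 ⊆ range F)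
    (hv : QuasiconvexOn ℝ univ v) :
    ∃ a b, a ≤ b ∧ leftTrunc F τ a = rightTrunc F τ b ∧ Solves F τ v (HC F τ a b) := by
  have hl : MonotoneOn (fun u => quantile F (τ * u)) (Ioo 0 1) := fun u hu w hw huw =>
    monotoneOn_quantile hF (mul_mem_Ioo_zero_one hτ hu) (mul_mem_Ioo_zero_one hτ hw)
      (mul_le_mul_of_nonneg_left huw hτ.1.le)
  have hr : MonotoneOn (fun u => quantile F (τ + (1 - τ) * u)) (Ioo 0 1) := fun u hu w hw huw =>
    monotoneOn_quantile hF (add_one_sub_mul_mem_Ioo_zero_one hτ hu)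
      (add_one_sub_mul_mem_Ioo_zero_one hτ hw)
      (add_le_add_right (mul_le_mul_of_nonneg_left huw (sub_nonneg.2 hτ.2.le)) τ)
  have hlr (u : ℝ) (hu : u ∈ Ioo (0 : ℝ) 1) : quantile F (τ * u) ≤ quantile F (τ + (1 - τ) * u) :=
    monotoneOn_quantile hF (mul_mem_Ioo_zero_one hτ hu) (add_one_sub_mul_mem_Ioo_zero_one hτ hu)
      (by nlinarith [hτ.1, hτ.2, hu.1, hu.2])
  obtain ⟨η, hη, hswitch⟩ := exists_switch_of_quasiconvexOn hv zero_le_one hl hr hlr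
  obtain ⟨a, b, hab, rfl, hb⟩ := exists_lt_leftTrunc_eq_rightTrunc_eq hτ hrange hη
  obtain ⟨H, hH, hHC⟩ := exists_mem_monotoneInterval_eq_HC hF hτ hb.symm
  refine ⟨a, b, hab.le, hb.symm, hHC ▸ solves_of_ae_isMaxOn_quantile hF hτ
    (measurable_of_quasiconvexOn hv) hH ?_⟩
  filter_upwards [Measure.ae_ne volume (leftTrunc F τ a)] with u hne hu
  rw [hHC]
  rcases hne.lt_or_gt with hlt | hgt
  · rw [quantile_HC_of_lt hF hτ hb.symm hu hlt]
    exact (hswitch u hu).1 hlt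
  · rw [quantile_HC_of_gt hF hτ hab.le hb.symm hu hgt]
    exact (hswitch u hu).2 hgt

end Censoring

end Solutions

section Nonuniqueness

variable {F : StieltjesFunction ℝ} {τ ε : ℝ} {v : ℝ → ℝ}

/-- The perturbation `F + ε F (1 - F)` of a distribution function. Together with the perturbation
for `-ε` it exhibits `F` as a midpoint. -/
def tilt (hF : IsCDF F) (hε : |ε| ≤ 1) : StieltjesFunction ℝ where
  toFun x := F x + ε * (F x * (1 - F x))
  mono' x y hxy := by
    have hslope : 0 ≤ 1 + ε * (1 - F x - F y) := by
      have hle : |ε * (1 - F x - F y)| ≤ 1 := by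
        rw [abs_mul]
        refine mul_le_one₀ hε (abs_nonneg _) (abs_le.2 ⟨?_, ?_⟩)
        · linarith [hF.le_one x, hF.le_one y]
        · linarith [hF.nonneg x, hF.nonneg y]
      linarith [neg_le_of_abs_le hle]
    dsimp only
    linarith [mul_nonneg (sub_nonneg.2 (F.mono hxy)) hslope]
  right_continuous' x := by
    have hFx := F.right_continuous x
    exact hFx.add ((hFx.mul (continuousWithinAt_const.sub hFx)).const_mul ε)

lemma tilt_apply (hF : IsCDF F) (hε : |ε| ≤ 1) (x : ℝ) :
    tilt hF hε x = F x + ε * (F x * (1 - F x)) := rfl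

lemma tilt_add_tilt_neg (hF : IsCDF F) (hε : |ε| ≤ 1) (hε' : |-ε| ≤ 1) :
    tilt hF hε + tilt hF hε' = F + F := by
  ext x
  simp only [StieltjesFunction.add_apply, tilt_apply]
  ring

lemma tilt_ne (hF : IsCDF F) (hε : |ε| ≤ 1) (hε0 : ε ≠ 0) {x : ℝ} (hx : F x ∈ Ioo (0 : ℝ) 1) :
    (tilt hF hε : ℝ → ℝ) ≠ F := fun h => by
  have hprod : ε * (F x * (1 - F x)) = 0 := by simpa [tilt_apply] using congrFun h x
  exact mul_ne_zero hε0 (mul_pos hx.1 (sub_pos.2 hx.2)).ne' hprod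

lemma tilt_mem_monotoneInterval (hF : IsCDF F) (hε : |ε| ≤ 1) (hτ : τ ∈ Ioo (0 : ℝ) 1)
    (hετ : |ε| ≤ τ) (hετ' : |ε| ≤ 1 - τ) :
    tilt hF hε ∈ monotoneInterval (rightTrunc F τ) (leftTrunc F τ) := fun x => by
  have h0 := hF.nonneg x
  have h1 := sub_nonneg.2 (hF.le_one x)
  have hscale {t : ℝ} (ht : 0 ≤ t) (ht1 : t ≤ 1) : -|ε| ≤ ε * t ∧ ε * t ≤ |ε| := by
    rw [← abs_le, abs_mul, abs_of_nonneg ht]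
    exact mul_le_of_le_one_right (abs_nonneg ε) ht1
  have hnonneg : 0 ≤ F x + ε * (F x * (1 - F x)) := by
    have hfactor : 0 ≤ 1 + ε * (1 - F x) := by linarith [(hscale h1 (by linarith)).1]
    linarith [mul_nonneg h0 hfactor]
  have hle_one : F x + ε * (F x * (1 - F x)) ≤ 1 := by
    have hfactor : 0 ≤ 1 - ε * F x := by linarith [(hscale h0 (hF.le_one x)).2]
    linarith [mul_nonneg h1 hfactor]
  rw [tilt_apply, rightTrunc_le_iff hτ.2 hnonneg, le_leftTrunc_iff hτ.1 hle_one]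
  constructor
  · have hfactor : 0 ≤ τ + ε * ((1 - τ) * F x) := by
      linarith [(hscale (mul_nonneg (sub_nonneg.2 hτ.2.le) h0)
        (mul_le_one₀ (sub_le_self 1 hτ.1.le) h0 (hF.le_one x))).1]
    linarith [mul_nonneg h1 hfactor]
  · have hfactor : 0 ≤ 1 - τ - ε * (τ * (1 - F x)) := by
      linarith [(hscale (mul_nonneg hτ.1.le h1) (mul_le_one₀ hτ.2.le h1 (sub_le_self 1 h0))).2]
    linarith [mul_nonneg h0 hfactor]

theorem setOf_solves_ne_singleton (hF : IsCDF F) (hτ : τ ∈ Ioo (0 : ℝ) 1)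
    (hFx : ∃ x, F x ∈ Ioo (0 : ℝ) 1) : {H : ℝ → ℝ | Solves F τ v H} ≠ {(F : ℝ → ℝ)} := by
  intro heq
  obtain ⟨x, hx⟩ := hFx
  have hFsolves : Solves F τ v F := heq.superset (mem_singleton _)
  obtain ⟨-, hmax⟩ := solves_iff_isMaxOn_payoff.1 hFsolves
  have hnot_le {ε : ℝ} (hε : |ε| ≤ 1) (hε0 : ε ≠ 0) (hετ : |ε| ≤ τ) (hετ' : |ε| ≤ 1 - τ) :
      ¬ payoff v F ≤ payoff v (tilt hF hε) := fun hle => by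
    have hsolves : Solves F τ v (tilt hF hε) := solves_iff_isMaxOn_payoff.2
      ⟨tilt_mem_monotoneInterval hF hε hτ hετ hετ', fun K hK => (hmax hK).trans hle⟩
    exact tilt_ne hF hε hε0 hx (heq.subset hsolves)
  obtain ⟨ε, hε0, hε⟩ := exists_between (lt_min hτ.1 (sub_pos.2 hτ.2))
  obtain ⟨hετ, hετ'⟩ := lt_min_iff.1 hε
  rw [← abs_of_pos hε0] at hετ hετ'
  have hε1 : |ε| ≤ 1 := (hετ.trans hτ.2).le
  have hε1' : |-ε| ≤ 1 := (abs_neg ε).trans_le hε1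
  rcases le_max_iff.1 (payoff_le_max_of_add_eq_add_self (v := v)
    (tilt_add_tilt_neg hF hε1 hε1')) with hle | hle
  · exact hnot_le hε1 hε0.ne' hετ.le hετ'.le hle
  · exact hnot_le hε1' (neg_ne_zero.2 hε0.ne') ((abs_neg ε).trans_le hετ.le)
      ((abs_neg ε).trans_le hετ'.le) hle

end Nonuniqueness

end QuantilePersuasion

open QuantilePersuasion in
theorem corollary4_general (F : StieltjesFunction ℝ) (hF : IsCDF F) (τ : ℝ)
    (hτ : τ ∈ Ioo (0 : ℝ) 1) (v : ℝ → ℝ) :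
    (∀ a, QuasiconcaveOn ℝ univ v → (∀ x, v x ≤ v a) → a ≤ quantile F τ →
      Solves F τ v (HL F τ a)) ∧
    (∀ a, QuasiconcaveOn ℝ univ v → (∀ x, v x ≤ v a) → quantile F τ ≤ a →
      Solves F τ v (HR F τ a)) ∧
    (Icc 0 1 ⊆ range F → QuasiconvexOn ℝ univ v →
      ∃ a b, a ≤ b ∧ leftTrunc F τ a = rightTrunc F τ b ∧ Solves F τ v (HC F τ a b)) ∧
    ((∃ x, F x ∈ Ioo (0 : ℝ) 1) → {H : ℝ → ℝ | Solves F τ v H} ≠ {(F : ℝ → ℝ)}) :=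
  ⟨fun _ hv hmax ha => solves_HL hF hτ hv hmax ha, fun _ hv hmax ha => solves_HR hF hτ hv hmax ha,
    exists_solves_HC hF hτ, setOf_solves_ne_singleton hF hτ⟩

theorem corollary4 (F : StieltjesFunction ℝ) (hF : QuantilePersuasion.IsCDF F)
    (hFcont : Continuous F)
    (lo hi : ℝ) (hFsupp : F.measure.support = Set.Icc lo hi)
    (τ : ℝ) (hτ : τ ∈ Set.Ioo (0 : ℝ) 1)
    (v : ℝ → ℝ) (hv : UpperSemicontinuous v) :
    (∀ a : ℝ, QuasiconcaveOn ℝ Set.univ v → (∀ x, v x ≤ v a) →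
      a ≤ QuantilePersuasion.quantile F τ →
      QuantilePersuasion.Solves F τ v (QuantilePersuasion.HL F τ a)) ∧
    (∀ a : ℝ, QuasiconcaveOn ℝ Set.univ v → (∀ x, v x ≤ v a) →
      QuantilePersuasion.quantile F τ < a →
      QuantilePersuasion.Solves F τ v (QuantilePersuasion.HR F τ a)) ∧
    (QuantilePersuasion.StrictQuasiconvex v →
      ∃ a b : ℝ, a ≤ b ∧
        QuantilePersuasion.leftTrunc F τ a = QuantilePersuasion.rightTrunc F τ b ∧
        QuantilePersuasion.Solves F τ v (QuantilePersuasion.HC F τ a b)) ∧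
    {H : ℝ → ℝ | QuantilePersuasion.Solves F τ v H} ≠ {(F : ℝ → ℝ)} := by
  have hrange : Icc 0 1 ⊆ range F := hF.Icc_zero_one_subset_range hFcont hFsupp.subset
  obtain ⟨x, hx⟩ := hrange (Ioo_subset_Icc_self hτ)
  obtain ⟨hL, hR, hC, hU⟩ := corollary4_general F hF τ hτ v
  exact ⟨hL, fun a hq hmax ha => hR a hq hmax ha.le, fun hq => hC hrange hq.quasiconvexOn,
    hU ⟨x, hx ▸ hτ⟩⟩
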